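/- Let $n\ge 3$ be an integer and, for $\rho\in(0,1)$, let \[ \Phi(\rho)=\int_{-1}^1 \frac{\left|t-\frac{n-2}{n}\rho\right|(1-t^2)^{\frac{n-3}{2}}}{(1-2t\rho+\rho^2)^{\frac{n-2}{2}}}\,dt . \] Let ${}_2F_1(a,b;c;z)=\sum_{k\ge 0}\frac{(a)_k(b)_k}{(c)_k\,k!}z^k$ $(|z|<1)$ be the Gauss hypergeometric function, where $(\lambda)_0=1$ and $(\lambda)_k=\lambda(\lambda+1)\cdots(\lambda+k-1)$ for $k\ge1$. Then the integral defining $\Phi(\rho)$ converges for every $\rho\in(0,1)$, $\Phi$ is twice differentiable on $(0,1)$, and for every $\rho\in(0,1)$ the number \[ z(\rho)=\frac{\rho^2\left[1-\frac{(n-2)^2}{n^2}\rho^2\right]}{1-\frac{n-4}{n}\rho^2} \] satisfies $|z(\rho)|<1$, and \begin{align*} \Phi''(\rho)={}&\frac{2(n-2)}{\rho^2}\left[1-\frac{(n-2)^2}{n^2}\rho^2\right]^{\frac{n-3}{2}}\left(1-\frac{n-4}{n}\rho^2\right)^{-\frac n2}\\ &\times\Biggl\{\left[1-\frac{(n-2)(n-3)}{n^2}\rho^2\right]\left(1-\frac{n-4}{n}\rho^2\right)\\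 &\qquad-\left[1-\frac{(n-2)(n-3)}{n(n-1)}\rho^2\right]\left(1-\frac{(n-2)^2}{n^2}\rho^2\right)\left(1-\frac{n-2}{n}\rho^2\right)\,{}_2F_1\!\left(1,\frac n2;\frac{n+1}{2};z(\rho)\right)\Biggr\}. \end{align*} -/

import Mathlib

open Set

/-- `Φ(ρ) = ∫_{-1}^{1} |t - (n-2)/n ρ| (1-t²)^{(n-3)/2} / (1-2tρ+ρ²)^{(n-2)/2} dt`: the integrand. -/
noncomputable def PhiIntegrand (n : ℕ) (ρ t : ℝ) : ℝ :=
  |t - ((n : ℝ) - 2) / n * ρ| * (1 - t ^ 2) ^ (((n : ℝ) - 3) / 2) /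
    (1 - 2 * t * ρ + ρ ^ 2) ^ (((n : ℝ) - 2) / 2)

/-- The function `Φ` (in dimension `n`). -/
noncomputable def Phi (n : ℕ) (ρ : ℝ) : ℝ :=
  ∫ t in (-1 : ℝ)..1, PhiIntegrand n ρ t

/-- The argument `ρ² [1 - (n-2)²/n² ρ²] / (1 - (n-4)/n ρ²)` of the hypergeometric function. -/
noncomputable def hypArg (n : ℕ) (ρ : ℝ) : ℝ :=
  ρ ^ 2 * (1 - ((n : ℝ) - 2) ^ 2 / (n : ℝ) ^ 2 * ρ ^ 2) / (1 - ((n : ℝ) - 4) / n * ρ ^ 2)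

/-! With `a = (n-2)/n`, the absolute value changes sign only at `t = aρ`, so `Φ` is minus the sum of
two signed integrals, based at `1` and at `-1`, with common moving limit `aρ` (`phi_eq`). The
Leibniz rule applies twice: the first boundary term vanishes because the integrand is zero at `t =
aρ`, the second survives. The `ρ`-second derivative of the integrand has a primitive in `t`, up to
the factor `ρ²`, that vanishes at both `±1` (`hasDerivAt_secondPrimitive`), so both integrals equal
its value at `aρ`. Its non-elementary part is the flux of the Newtonian kernel through a spherical
cap; `hasDerivAt_fluxPrimitive` expresses it by `₂F₁(1, n/2; (n+1)/2; ·)`, thanks to the first-order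
equation that the parameter `1` provides. -/

/-! ### Differentiation under the integral with a moving endpoint. -/

open Filter Topology MeasureTheory in
/-- Derivative of an integral over an interval with one endpoint fixed at the base point. -/
theorem hasDerivAt_integral_moving_endpoint {f : ℝ → ℝ → ℝ} {U K : Set ℝ} (hU : IsOpen U)
    [K.OrdConnected] {a ρ : ℝ} (hρ : ρ ∈ U) (ha : a * ρ ∈ interior K)
    (hf : ContinuousOn (Function.uncurry f) (U ×ˢ K)) :
    HasDerivAt (fun r => ∫ t in (a * ρ)..(a * r), f r t) (a * f ρ (a * ρ)) ρ := by
  have hUK : U ×ˢ K ∈ 𝓝 (ρ, a * ρ) :=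
    prod_mem_nhds (hU.mem_nhds hρ) (mem_interior_iff_mem_nhds.1 ha)
  have hc : ContinuousAt (Function.uncurry f) (ρ, a * ρ) := hf.continuousAt hUK
  rw [hasDerivAt_iff_isLittleO, Asymptotics.isLittleO_iff]
  intro c hc0
  -- The added `1` covers `a = 0`.
  obtain ⟨ε, hε, hεa⟩ : ∃ ε > 0, ε * |a| ≤ c :=
    ⟨c / (|a| + 1), by positivity, by
      rw [div_mul_eq_mul_div, div_le_iff₀ (by positivity)]
      nlinarith [abs_nonneg a]⟩
  have hnear : ∀ᶠ p : ℝ × ℝ in 𝓝 (ρ, a * ρ),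
      p ∈ U ×ˢ K ∧ dist (Function.uncurry f p) (f ρ (a * ρ)) < ε :=
    (eventually_mem_set.2 hUK).and (Metric.tendsto_nhds.1 hc ε hε)
  rw [Metric.eventually_nhds_iff] at hnear
  obtain ⟨δ, hδ, hball⟩ := hnear
  have hev : ∀ᶠ r in 𝓝 ρ, dist r ρ < δ ∧ dist (a * r) (a * ρ) < δ := by
    have h1 : Tendsto (fun r => a * r) (𝓝 ρ) (𝓝 (a * ρ)) :=
      (continuous_const.mul continuous_id).tendsto ρ
    exact (show ∀ᶠ r in 𝓝 ρ, dist r ρ < δ from Metric.ball_mem_nhds ρ hδ).and (Metric.tendsto_nhds.1 h1 δ hδ)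
  filter_upwards [hev] with r ⟨hr1, hr2⟩
  have hseg : ∀ t ∈ uIcc (a * ρ) (a * r), (r, t) ∈ U ×ˢ K ∧
      dist (f r t) (f ρ (a * ρ)) < ε := by
    intro t ht
    refine hball (y := (r, t)) ?_
    rw [Prod.dist_eq]
    refine max_lt hr1 (lt_of_le_of_lt ?_ hr2)
    rw [Real.dist_eq, Real.dist_eq]
    exact abs_sub_left_of_mem_uIcc ht
  have hint : IntervalIntegrable (f r) volume (a * ρ) (a * r) := by
    refine ContinuousOn.intervalIntegrable ?_
    exact hf.comp (f := fun t => (r, t)) (by fun_prop) fun t ht => (hseg t ht).1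
  have hb := intervalIntegral.norm_integral_le_of_norm_le_const (a := a * ρ) (b := a * r)
    (f := fun t => f r t - f ρ (a * ρ)) (C := ε)
    (fun t ht => by
      rw [← dist_eq_norm]
      exact (hseg t (uIoc_subset_uIcc ht)).2.le)
  rw [intervalIntegral.integral_sub hint (by simp), intervalIntegral.integral_const] at hb
  simp only [intervalIntegral.integral_same, sub_zero, smul_eq_mul] at hb ⊢
  calc _ = ‖(∫ t in (a * ρ)..(a * r), f r t) - (a * r - a * ρ) * f ρ (a * ρ)‖ := by
        congr 1; ring
    _ ≤ ε * |a * r - a * ρ| := hb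
    _ = ε * |a| * |r - ρ| := by rw [← mul_sub, abs_mul]; ring
    _ ≤ c * ‖r - ρ‖ := by rw [Real.norm_eq_abs]; gcongr

open Filter Topology MeasureTheory in
/-- Leibniz rule for an integral between a fixed endpoint and a linearly moving one. -/
theorem hasDerivAt_integral_leibniz {f f' : ℝ → ℝ → ℝ} {U : Set ℝ} (hU : IsOpen U)
    {a e b c ρ : ℝ} (hρ : ρ ∈ U) (ha : a * ρ ∈ Ioo b c) (he : e ∈ Icc b c)
    (hf : ContinuousOn (Function.uncurry f) (U ×ˢ Icc b c))
    (hf' : ContinuousOn (Function.uncurry f') (U ×ˢ Icc b c))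
    (hd : ∀ r ∈ U, ∀ t ∈ Icc b c, HasDerivAt (fun x => f x t) (f' r t) r) :
    HasDerivAt (fun r => ∫ t in e..(a * r), f r t)
      (a * f ρ (a * ρ) + ∫ t in e..(a * ρ), f' ρ t) ρ := by
  have hsub : ∀ x ∈ Icc b c, ∀ y ∈ Icc b c, uIcc x y ⊆ Icc b c :=
    fun x hx y hy => OrdConnected.uIcc_subset inferInstance hx hy
  have ha' : a * ρ ∈ Icc b c := Ioo_subset_Icc_self ha
  have hslice : ∀ {g : ℝ → ℝ → ℝ}, ContinuousOn (Function.uncurry g) (U ×ˢ Icc b c) →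
      ∀ r ∈ U, ContinuousOn (g r) (Icc b c) := fun hg r hr =>
    hg.comp (f := fun t => (r, t)) (by fun_prop) fun t ht => ⟨hr, ht⟩
  have hint : ∀ {g : ℝ → ℝ → ℝ}, ContinuousOn (Function.uncurry g) (U ×ˢ Icc b c) →
      ∀ r ∈ U, ∀ x ∈ Icc b c, ∀ y ∈ Icc b c, IntervalIntegrable (g r) volume x y :=
    fun hg r hr x hx y hy => ((hslice hg r hr).mono (hsub x hx y hy)).intervalIntegrable
  -- Compactness of the box around `ρ` gives a constant dominating `f'`.
  obtain ⟨δ, hδ, hδU⟩ := Metric.nhds_basis_closedBall.mem_iff.1 (hU.mem_nhds hρ)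
  obtain ⟨C, hC⟩ := ((isCompact_closedBall ρ δ).prod
    (isCompact_Icc (a := b) (b := c))).exists_bound_of_continuousOn
      (hf'.mono (prod_mono_left hδU))
  have hfix : HasDerivAt (fun r => ∫ t in e..(a * ρ), f r t) (∫ t in e..(a * ρ), f' ρ t) ρ := by
    have hm : uIoc e (a * ρ) ⊆ Icc b c := uIoc_subset_uIcc.trans (hsub e he _ ha')
    refine (intervalIntegral.hasDerivAt_integral_of_dominated_loc_of_deriv_le
      (Metric.closedBall_mem_nhds ρ hδ) ?_ (hint hf ρ hρ e he _ ha')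
      (intervalIntegrable_iff.1 (hint hf' ρ hρ e he _ ha')).aestronglyMeasurable
      (bound := fun _ => C) ?_ (by simp) ?_).2
    · filter_upwards [hU.mem_nhds hρ] with r hr
      exact (intervalIntegrable_iff.1 (hint hf r hr e he _ ha')).aestronglyMeasurable
    · exact .of_forall fun t ht x hx => hC (x, t) ⟨hx, hm ht⟩
    · exact .of_forall fun t ht x hx => hd x (hδU hx) t (hm ht)
  have hmov := hasDerivAt_integral_moving_endpoint hU (K := Icc b c) hρ
    (by rwa [interior_Icc]) hf
  rw [add_comm]
  refine (hfix.add hmov).congr_of_eventuallyEq ?_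
  have h1 : Tendsto (fun r => a * r) (𝓝 ρ) (𝓝 (a * ρ)) :=
    (continuous_const.mul continuous_id).tendsto ρ
  filter_upwards [hU.mem_nhds hρ, h1 (Icc_mem_nhds ha.1 ha.2)] with r hr har
  exact (intervalIntegral.integral_add_adjacent_intervals (hint hf r hr e he _ ha')
    (hint hf r hr _ ha' _ har)).symm

/-! ### The hypergeometric function with first parameter one. -/

/-- Coefficient recursion of `₂F₁(1, b; c; z)`, in the form `(c + k) u (k + 1) = (b + k) u k`. -/
theorem ordinaryHypergeometricCoefficient_one_succ {b c : ℝ} (hc : 0 < c) (k : ℕ) :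
    (c + k) * ordinaryHypergeometricCoefficient 1 b c (k + 1) =
      (b + k) * ordinaryHypergeometricCoefficient 1 b c k := by
  have h1 : (ascPochhammer ℝ k).eval c ≠ 0 := (ascPochhammer_pos k c hc).ne'
  have h2 : c + k ≠ 0 := by positivity
  have h3 : (k : ℝ) + 1 ≠ 0 := by positivity
  have h4 : (k.factorial : ℝ) ≠ 0 := by positivity
  simp only [ordinaryHypergeometricCoefficient, ascPochhammer_succ_eval, Nat.factorial_succ]
  push_cast
  field_simp
  ring

/-- Successive ratios `(b + k) / (c + k)` are at most `1`. The bound lets geometric series dominate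
`₂F₁` and its termwise derivative. -/
theorem abs_ordinaryHypergeometricCoefficient_one_le {b c : ℝ} (hb : 0 < b) (hbc : b ≤ c)
    (k : ℕ) : |ordinaryHypergeometricCoefficient 1 b c k| ≤ 1 := by
  induction k with
  | zero => simp [ordinaryHypergeometricCoefficient]
  | succ k ih =>
    have hc : 0 < c := hb.trans_le hbc
    have h := congrArg abs (ordinaryHypergeometricCoefficient_one_succ (b := b) hc k)
    rw [abs_mul (c + k), abs_mul (b + k), abs_of_pos (by positivity : 0 < c + k),
      abs_of_pos (by positivity : 0 < b + k)] at h
    have hk : 0 < c + k := by positivity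
    have h2 : (b + k) * |ordinaryHypergeometricCoefficient 1 b c k| ≤ (c + k) * 1 :=
      mul_le_mul (by linarith) ih (abs_nonneg _) hk.le
    rw [← h] at h2
    exact le_of_mul_le_mul_left h2 hk

theorem ordinaryHypergeometric_one_eq_tsum (b c z : ℝ) :
    ordinaryHypergeometric 1 b c z =
      ∑' k : ℕ, ordinaryHypergeometricCoefficient 1 b c k * z ^ k := by
  rw [ordinaryHypergeometric_eq_tsum]
  rfl

/-- `₂F₁(1, b; c; ·)` solves a first-order equation. -/
theorem hasDerivAt_ordinaryHypergeometric_one {b c z : ℝ} (hb : 0 < b) (hbc : b ≤ c)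
    (hz : |z| < 1) : ∃ d, HasDerivAt (ordinaryHypergeometric (𝔸 := ℝ) 1 b c) d z ∧
      z * (1 - z) * d + (c - 1 - b * z) * ordinaryHypergeometric 1 b c z = c - 1 := by
  obtain ⟨u, hu⟩ : ∃ u : ℕ → ℝ, u = ordinaryHypergeometricCoefficient 1 b c := ⟨_, rfl⟩
  have hu1 : ∀ k, |u k| ≤ 1 := hu ▸ abs_ordinaryHypergeometricCoefficient_one_le hb hbc
  obtain ⟨r, hzr, hr1⟩ := exists_between hz
  have hr0 : 0 < r := (abs_nonneg z).trans_lt hzr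
  have hrn : ‖r‖ < 1 := by rwa [Real.norm_of_nonneg hr0.le]
  have hsr : Summable fun k : ℕ => (k : ℝ) * r ^ (k - 1) := by
    refine (summable_nat_add_iff 1).1 ?_
    have h := (summable_pow_mul_geometric_of_norm_lt_one 1 hrn).add
      (summable_geometric_of_norm_lt_one hrn)
    refine h.congr fun k => ?_
    push_cast
    simp
    ring
  have hder_bound : ∀ (k : ℕ) (y : ℝ), y ∈ Metric.ball (0 : ℝ) r →
      ‖u k * ((k : ℝ) * y ^ (k - 1))‖ ≤ (k : ℝ) * r ^ (k - 1) := by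
    intro k y hy
    rw [mem_ball_zero_iff, Real.norm_eq_abs] at hy
    rw [norm_mul, norm_mul, norm_pow, Real.norm_eq_abs, Real.norm_eq_abs, Real.norm_eq_abs,
      abs_of_nonneg (Nat.cast_nonneg k : (0 : ℝ) ≤ k)]
    calc |u k| * (k * |y| ^ (k - 1)) ≤ 1 * (k * r ^ (k - 1)) := by
          gcongr
          exact hu1 k
      _ = _ := one_mul _
  have hzb : z ∈ Metric.ball (0 : ℝ) r := by simpa using hzr
  have hS : Summable fun k => u k * z ^ k := by
    refine Summable.of_norm_bounded (summable_geometric_of_norm_lt_one hrn) fun k => ?_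
    rw [norm_mul, norm_pow, Real.norm_eq_abs, Real.norm_eq_abs]
    calc |u k| * |z| ^ k ≤ 1 * r ^ k := by
          gcongr
          exact hu1 k
      _ = _ := one_mul _
  have hD : Summable fun k : ℕ => u k * ((k : ℝ) * z ^ (k - 1)) :=
    Summable.of_norm_bounded hsr fun k => hder_bound k z hzb
  have hderiv := hasDerivAt_tsum_of_isPreconnected (g := fun k y => u k * y ^ k)
    (g' := fun k y => u k * ((k : ℝ) * y ^ (k - 1))) hsr Metric.isOpen_ball
    (convex_ball (0 : ℝ) r).isPreconnected
    (fun k y _ => (hasDerivAt_pow k y).const_mul (u k)) hder_bound hzb hS hzb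
  refine ⟨∑' k : ℕ, u k * ((k : ℝ) * z ^ (k - 1)), ?_, ?_⟩
  · exact hderiv.congr_of_eventuallyEq
      (.of_forall fun y => hu ▸ ordinaryHypergeometric_one_eq_tsum b c y)
  · rw [ordinaryHypergeometric_one_eq_tsum, ← hu]
    have hzD : Summable fun k : ℕ => (k : ℝ) * u k * z ^ k := by
      refine (hD.mul_left z).congr fun k => ?_
      rcases k with _ | k
      · simp
      · simp only [Nat.add_sub_cancel]; ring
    have hzDe : z * ∑' k : ℕ, u k * ((k : ℝ) * z ^ (k - 1)) = ∑' k : ℕ, (k : ℝ) * u k * z ^ k := by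
      rw [← tsum_mul_left]
      refine tsum_congr fun k => ?_
      rcases k with _ | k
      · simp
      · simp only [Nat.add_sub_cancel]; ring
    have hA : Summable fun k : ℕ => (c - 1 + k) * (u k * z ^ k) :=
      ((hS.mul_left (c - 1)).add hzD).congr fun k => by ring
    have hAe : ∑' k : ℕ, (c - 1 + k) * (u k * z ^ k) =
        (c - 1) * ∑' k, u k * z ^ k + ∑' k : ℕ, (k : ℝ) * u k * z ^ k := by
      rw [← tsum_mul_left, ← (hS.mul_left (c - 1)).tsum_add hzD]
      exact tsum_congr fun k => by ring
    have hBe : ∑' k : ℕ, (b + k) * (u k * z ^ k) =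
        b * ∑' k, u k * z ^ k + ∑' k : ℕ, (k : ℝ) * u k * z ^ k := by
      rw [← tsum_mul_left, ← (hS.mul_left b).tsum_add hzD]
      exact tsum_congr fun k => by ring
    -- The recursion summed over `k`: the unmatched `k = 0` term is the inhomogeneity `c - 1`.
    have hshift : ∑' k : ℕ, (c - 1 + k) * (u k * z ^ k) =
        c - 1 + z * ∑' k : ℕ, (b + k) * (u k * z ^ k) := by
      rw [hA.tsum_eq_zero_add, ← tsum_mul_left]
      congr 1
      · simp [hu, ordinaryHypergeometricCoefficient]
      · refine tsum_congr fun k => ?_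
        have h := ordinaryHypergeometricCoefficient_one_succ (b := b) (hb.trans_le hbc) k
        rw [← hu] at h
        push_cast
        rw [pow_succ]
        linear_combination z ^ k * z * h
    rw [hAe, hBe] at hshift
    linear_combination hshift + (1 - z) * hzDe

/-! ### The kernel and its derivatives in `ρ`. -/

/-- The squared distance `1 - 2tρ + ρ²`. -/
def distSq (ρ t : ℝ) : ℝ := 1 - 2 * t * ρ + ρ ^ 2

theorem distSq_pos {ρ t : ℝ} (hρ : ρ ∈ Ioo (0 : ℝ) 1) (ht : t ∈ Icc (-1 : ℝ) 1) :
    0 < distSq ρ t := by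
  unfold distSq
  nlinarith [hρ.1, hρ.2, ht.2, mul_nonneg hρ.1.le (sub_nonneg.2 ht.2), sq_pos_of_pos (sub_pos.2 hρ.2)]

theorem mul_lt_one_of_mem {ρ t : ℝ} (hρ : ρ ∈ Ioo (0 : ℝ) 1) (ht : t ∈ Icc (-1 : ℝ) 1) :
    t * ρ < 1 := by
  nlinarith [hρ.1, hρ.2, ht.2]

theorem hasDerivAt_distSq_rpow_left {ρ t : ℝ} (s : ℝ) (h : 0 < distSq ρ t) :
    HasDerivAt (fun x => distSq x t ^ s) (2 * (ρ - t) * s * distSq ρ t ^ (s - 1)) ρ := by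
  have h1 : HasDerivAt (fun x => distSq x t) (2 * (ρ - t)) ρ := by
    have := (((hasDerivAt_id ρ).const_mul (2 * t)).const_sub 1).add (hasDerivAt_pow 2 ρ)
    refine this.congr_deriv ?_
    push_cast
    ring
  exact h1.rpow_const (.inl h.ne')

theorem hasDerivAt_distSq_right (ρ t : ℝ) : HasDerivAt (fun x => distSq ρ x) (-(2 * ρ)) t := by
  have := (((hasDerivAt_id t).mul_const (2 * ρ)).const_sub 1).add_const (ρ ^ 2)
  refine (this.congr_deriv (by ring)).congr_of_eventuallyEq (.of_forall fun x => ?_)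
  simp [distSq]
  ring

theorem hasDerivAt_distSq_rpow_right {ρ t : ℝ} (s : ℝ) (h : 0 < distSq ρ t) :
    HasDerivAt (fun x => distSq ρ x ^ s) (-(2 * ρ) * s * distSq ρ t ^ (s - 1)) t :=
  (hasDerivAt_distSq_right ρ t).rpow_const (.inl h.ne')

theorem continuousOn_distSq_rpow (s : ℝ) :
    ContinuousOn (fun p : ℝ × ℝ => distSq p.1 p.2 ^ s) (Ioo (0 : ℝ) 1 ×ˢ Icc (-1 : ℝ) 1) := by
  refine ContinuousOn.rpow_const (by unfold distSq; fun_prop) fun p hp => ?_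
  exact .inl (distSq_pos hp.1 hp.2).ne'

theorem continuous_weight {s : ℝ} (hs : 0 ≤ s) : Continuous fun t : ℝ => (1 - t ^ 2) ^ s :=
  Continuous.rpow_const (by fun_prop) fun _ => .inr hs

/-- The integrand of `Phi` without the absolute value, for real parameters. -/
noncomputable def signedIntegrand (N a ρ t : ℝ) : ℝ :=
  (t - a * ρ) * (1 - t ^ 2) ^ ((N - 3) / 2) * distSq ρ t ^ (-((N - 2) / 2))

/-- The first `ρ`-derivative of `signedIntegrand`. -/
noncomputable def signedIntegrandDeriv (N a ρ t : ℝ) : ℝ :=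
  (1 - t ^ 2) ^ ((N - 3) / 2) * (-a * distSq ρ t ^ (-((N - 2) / 2))
    - (N - 2) * (t - a * ρ) * (ρ - t) * distSq ρ t ^ (-(N / 2)))

/-- The second `ρ`-derivative of `signedIntegrand`. -/
noncomputable def signedIntegrandDeriv2 (N a ρ t : ℝ) : ℝ :=
  (1 - t ^ 2) ^ ((N - 3) / 2) * ((N - 2) * (2 * a * (ρ - t) - (t - a * ρ)) * distSq ρ t ^ (-(N / 2))
    + N * (N - 2) * (t - a * ρ) * (ρ - t) ^ 2 * distSq ρ t ^ (-(N / 2) - 1))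

theorem hasDerivAt_signedIntegrand (N a : ℝ) {ρ t : ℝ} (h : 0 < distSq ρ t) :
    HasDerivAt (fun x => signedIntegrand N a x t) (signedIntegrandDeriv N a ρ t) ρ := by
  have h1 := (((hasDerivAt_id ρ).const_mul a).const_sub t).mul_const ((1 - t ^ 2) ^ ((N - 3) / 2))
  refine (h1.mul (hasDerivAt_distSq_rpow_left (-((N - 2) / 2)) h)).congr_deriv ?_
  rw [show -((N - 2) / 2) - 1 = -(N / 2) by ring]
  simp only [signedIntegrandDeriv, id]
  ring

theorem hasDerivAt_signedIntegrandDeriv (N a : ℝ) {ρ t : ℝ} (h : 0 < distSq ρ t) :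
    HasDerivAt (fun x => signedIntegrandDeriv N a x t) (signedIntegrandDeriv2 N a ρ t) ρ := by
  have h1 := (hasDerivAt_distSq_rpow_left (-((N - 2) / 2)) h).const_mul (-a)
  have h2 := (((((hasDerivAt_id ρ).const_mul a).const_sub t).const_mul (N - 2)).mul
    ((hasDerivAt_id ρ).sub_const t)).mul (hasDerivAt_distSq_rpow_left (-(N / 2)) h)
  refine ((h1.sub h2).const_mul ((1 - t ^ 2) ^ ((N - 3) / 2))).congr_deriv ?_
  rw [show -((N - 2) / 2) - 1 = -(N / 2) by ring]
  simp only [signedIntegrandDeriv2, id, Pi.mul_apply]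
  ring

theorem continuousOn_signedIntegrand {N : ℝ} (hN : 3 ≤ N) (a : ℝ) :
    ContinuousOn (Function.uncurry (signedIntegrand N a)) (Ioo (0 : ℝ) 1 ×ˢ Icc (-1 : ℝ) 1) := by
  have hw : Continuous fun p : ℝ × ℝ => (1 - p.2 ^ 2) ^ ((N - 3) / 2) :=
    (continuous_weight (by linarith)).comp continuous_snd
  have h1 : Continuous fun p : ℝ × ℝ => p.2 - a * p.1 := by fun_prop
  exact (h1.mul hw).continuousOn.mul (continuousOn_distSq_rpow _)

theorem continuousOn_signedIntegrandDeriv {N : ℝ} (hN : 3 ≤ N) (a : ℝ) :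
    ContinuousOn (Function.uncurry (signedIntegrandDeriv N a))
      (Ioo (0 : ℝ) 1 ×ˢ Icc (-1 : ℝ) 1) := by
  have hw : Continuous fun p : ℝ × ℝ => (1 - p.2 ^ 2) ^ ((N - 3) / 2) :=
    (continuous_weight (by linarith)).comp continuous_snd
  have h1 : Continuous fun p : ℝ × ℝ => (N - 2) * (p.2 - a * p.1) * (p.1 - p.2) := by fun_prop
  exact hw.continuousOn.mul ((continuousOn_const.mul (continuousOn_distSq_rpow _)).sub
    (h1.continuousOn.mul (continuousOn_distSq_rpow _)))

theorem continuousOn_signedIntegrandDeriv2 {N : ℝ} (hN : 3 ≤ N) (a : ℝ) :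
    ContinuousOn (Function.uncurry (signedIntegrandDeriv2 N a))
      (Ioo (0 : ℝ) 1 ×ˢ Icc (-1 : ℝ) 1) := by
  have hw : Continuous fun p : ℝ × ℝ => (1 - p.2 ^ 2) ^ ((N - 3) / 2) :=
    (continuous_weight (by linarith)).comp continuous_snd
  have h1 : Continuous fun p : ℝ × ℝ =>
    (N - 2) * (2 * a * (p.1 - p.2) - (p.2 - a * p.1)) := by fun_prop
  have h2 : Continuous fun p : ℝ × ℝ =>
    N * (N - 2) * (p.2 - a * p.1) * (p.1 - p.2) ^ 2 := by fun_prop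
  exact hw.continuousOn.mul ((h1.continuousOn.mul (continuousOn_distSq_rpow _)).add
    (h2.continuousOn.mul (continuousOn_distSq_rpow _)))

/-! ### Primitives in `t`. -/

/-- The hypergeometric argument `ρ² (1 - t²) / (1 - 2tρ + ρ²)`. -/
noncomputable def sphereArg (ρ t : ℝ) : ℝ := ρ ^ 2 * (1 - t ^ 2) / distSq ρ t

theorem one_sub_sphereArg {ρ t : ℝ} (h : distSq ρ t ≠ 0) :
    1 - sphereArg ρ t = (1 - t * ρ) ^ 2 / distSq ρ t := by
  unfold sphereArg
  rw [eq_div_iff h, sub_mul, div_mul_cancel₀ _ h]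
  unfold distSq
  ring

theorem abs_sphereArg_lt_one {ρ t : ℝ} (hρ : ρ ∈ Ioo (0 : ℝ) 1) (ht : t ∈ Icc (-1 : ℝ) 1) :
    |sphereArg ρ t| < 1 := by
  have hR := distSq_pos hρ ht
  have h1 : 0 < 1 - sphereArg ρ t := by
    rw [one_sub_sphereArg hR.ne']
    have := sub_pos.2 (mul_lt_one_of_mem hρ ht)
    positivity
  have h0 : 0 ≤ sphereArg ρ t := by
    have : 0 ≤ 1 - t ^ 2 := by nlinarith [ht.1, ht.2]
    unfold sphereArg
    positivity
  rw [abs_of_nonneg h0]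
  linarith

theorem hasDerivAt_sphereArg {ρ t : ℝ} (h : 0 < distSq ρ t) :
    HasDerivAt (sphereArg ρ) (2 * ρ ^ 2 * (ρ - t) * (1 - t * ρ) / distSq ρ t ^ 2) t := by
  have h1 := ((hasDerivAt_pow 2 t).const_sub 1).const_mul (ρ ^ 2)
  refine (h1.div (hasDerivAt_distSq_right ρ t) h.ne').congr_deriv ?_
  congr 1
  unfold distSq
  push_cast
  ring

/-- The radial flux primitive. -/
noncomputable def fluxPrimitive (N ρ t : ℝ) : ℝ :=
  (1 - t ^ 2) ^ ((N - 1) / 2) * (1 - t * ρ) * distSq ρ t ^ (-(N / 2)) *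
    ordinaryHypergeometric 1 (N / 2) ((N + 1) / 2) (sphereArg ρ t)

/-- The exponent is at least `1`, so `t = ±1` needs no exclusion. -/
theorem hasDerivAt_weight {N : ℝ} (hN : 3 ≤ N) (t : ℝ) :
    HasDerivAt (fun t : ℝ => (1 - t ^ 2) ^ ((N - 1) / 2))
      (-(N - 1) * t * (1 - t ^ 2) ^ ((N - 3) / 2)) t := by
  have h1 := ((hasDerivAt_pow 2 t).const_sub 1).rpow_const (p := (N - 1) / 2)
    (.inr (by linarith))
  refine h1.congr_deriv ?_
  rw [show (N - 1) / 2 - 1 = (N - 3) / 2 by ring]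
  push_cast
  ring

theorem weight_eq {N t : ℝ} (ht : 0 < 1 - t ^ 2) :
    (1 - t ^ 2) ^ ((N - 1) / 2) = (1 - t ^ 2) * (1 - t ^ 2) ^ ((N - 3) / 2) := by
  rw [show (N - 1) / 2 = (N - 3) / 2 + 1 by ring, Real.rpow_add_one ht.ne', mul_comm]

theorem distSq_rpow_neg_half {N ρ t : ℝ} (h : 0 < distSq ρ t) :
    distSq ρ t ^ (-(N / 2)) = distSq ρ t * distSq ρ t ^ (-(N / 2) - 1) := by
  conv_lhs => rw [show -(N / 2) = -(N / 2) - 1 + 1 by ring]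
  rw [Real.rpow_add_one h.ne', mul_comm]

theorem distSq_rpow_kernel {N ρ t : ℝ} (h : 0 < distSq ρ t) :
    distSq ρ t ^ (-((N - 2) / 2)) = distSq ρ t * distSq ρ t ^ (-(N / 2)) := by
  rw [show -((N - 2) / 2) = -(N / 2) + 1 by ring, Real.rpow_add_one h.ne', mul_comm]

theorem one_sub_sq_pos {t : ℝ} (ht : t ∈ Ioo (-1 : ℝ) 1) : 0 < 1 - t ^ 2 := by
  nlinarith [ht.1, ht.2]

/-- With `b = N/2`, `c = (N+1)/2`, the product rule yields `2 (ρ - t) (1 - t²)^((N-3)/2)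
distSq^(-N/2)` times the left side of the hypergeometric equation, which equals `(N-1)/2`. -/
theorem hasDerivAt_fluxPrimitive {N ρ t : ℝ} (hN : 3 ≤ N) (hρ : ρ ∈ Ioo (0 : ℝ) 1)
    (ht : t ∈ Ioo (-1 : ℝ) 1) :
    HasDerivAt (fluxPrimitive N ρ)
      ((N - 1) * (ρ - t) * (1 - t ^ 2) ^ ((N - 3) / 2) * distSq ρ t ^ (-(N / 2))) t := by
  have ht' := Ioo_subset_Icc_self ht
  have hR := distSq_pos hρ ht'
  obtain ⟨d, hd, hode⟩ := hasDerivAt_ordinaryHypergeometric_one (b := N / 2) (c := (N + 1) / 2)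
    (by linarith) (by linarith) (abs_sphereArg_lt_one hρ ht')
  have h1 := ((hasDerivAt_weight hN t).mul (((hasDerivAt_id t).mul_const ρ).const_sub 1)).mul
    (hasDerivAt_distSq_rpow_right (-(N / 2)) hR)
  refine (h1.mul (hd.comp t (hasDerivAt_sphereArg hR))).congr_deriv ?_
  simp only [Function.comp, id, Pi.mul_apply]
  rw [weight_eq (one_sub_sq_pos ht), distSq_rpow_neg_half hR]
  rw [one_sub_sphereArg hR.ne'] at hode
  generalize ordinaryHypergeometric (1 : ℝ) (N / 2) ((N + 1) / 2) (sphereArg ρ t) = F at hode ⊢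
  generalize (1 - t ^ 2) ^ ((N - 3) / 2) = W
  generalize distSq ρ t ^ (-(N / 2) - 1) = G
  unfold sphereArg at hode
  have hRe : distSq ρ t = 1 - 2 * t * ρ + ρ ^ 2 := rfl
  generalize distSq ρ t = R at hode hRe hR ⊢
  field_simp at hode ⊢
  subst hRe
  linear_combination W * G * (ρ - t) * hode

/-- A primitive in `t` of `ρ²` times the second derivative of the integrand. -/
noncomputable def secondPrimitive (N a ρ t : ℝ) : ℝ :=
  -((N - 2) * (1 - t ^ 2) ^ ((N - 1) / 2) *
    ((t - a * ρ) * ρ * distSq ρ t ^ (-(N / 2)) + distSq ρ t ^ (-((N - 2) / 2))))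
  - ((N - 3) * a * ρ ^ 2 - (N - 1)) * (N - 2) / (N - 1) * fluxPrimitive N ρ t

/-- The elementary part absorbs the power `-N/2 - 1` of `distSq`; what remains is a `t`-independent
multiple of the flux integrand. -/
theorem hasDerivAt_secondPrimitive {N a ρ t : ℝ} (hN : 3 ≤ N) (hρ : ρ ∈ Ioo (0 : ℝ) 1)
    (ht : t ∈ Ioo (-1 : ℝ) 1) :
    HasDerivAt (secondPrimitive N a ρ) (ρ ^ 2 * signedIntegrandDeriv2 N a ρ t) t := by
  have hR := distSq_pos hρ (Ioo_subset_Icc_self ht)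
  have h1 := ((((hasDerivAt_id t).sub_const (a * ρ)).mul_const ρ).mul
    (hasDerivAt_distSq_rpow_right (-(N / 2)) hR)).add
    (hasDerivAt_distSq_rpow_right (-((N - 2) / 2)) hR)
  have h2 := (((hasDerivAt_weight hN t).const_mul (N - 2)).mul h1).neg.sub
    ((hasDerivAt_fluxPrimitive hN hρ ht).const_mul
      (((N - 3) * a * ρ ^ 2 - (N - 1)) * (N - 2) / (N - 1)))
  refine h2.congr_deriv ?_
  simp only [signedIntegrandDeriv2, id, Pi.mul_apply, Pi.add_apply]
  rw [weight_eq (one_sub_sq_pos ht), show -((N - 2) / 2) - 1 = -(N / 2) by ring,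
    distSq_rpow_kernel hR, distSq_rpow_neg_half hR]
  generalize (1 - t ^ 2) ^ ((N - 3) / 2) = W
  generalize distSq ρ t ^ (-(N / 2) - 1) = G
  have hN1 : N - 1 ≠ 0 := by linarith
  unfold distSq
  field_simp
  ring

theorem continuousOn_secondPrimitive {N ρ : ℝ} (a : ℝ) (hN : 3 ≤ N) (hρ : ρ ∈ Ioo (0 : ℝ) 1) :
    ContinuousOn (secondPrimitive N a ρ) (Icc (-1) 1) := by
  intro t ht
  have hR := distSq_pos hρ ht
  obtain ⟨d, hd, -⟩ := hasDerivAt_ordinaryHypergeometric_one (b := N / 2) (c := (N + 1) / 2)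
    (by linarith) (by linarith) (abs_sphereArg_lt_one hρ ht)
  have hF := (hd.comp t (hasDerivAt_sphereArg hR)).continuousAt
  have hV := (hasDerivAt_weight hN t).continuousAt
  have h1 := (hasDerivAt_distSq_rpow_right (-(N / 2)) hR).continuousAt
  have h2 := (hasDerivAt_distSq_rpow_right (-((N - 2) / 2)) hR).continuousAt
  have hflux : ContinuousAt (fluxPrimitive N ρ) t :=
    ((hV.mul (by fun_prop)).mul h1).mul hF
  have h3 : ContinuousAt (fun t : ℝ => (t - a * ρ) * ρ) t := by fun_prop
  exact (((continuousAt_const.mul hV).mul ((h3.mul h1).add h2)).neg.sub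
    (continuousAt_const.mul hflux)).continuousWithinAt

theorem secondPrimitive_eq_zero {N t : ℝ} (a ρ : ℝ) (hN : 3 ≤ N) (ht : t ^ 2 = 1) :
    secondPrimitive N a ρ t = 0 := by
  have h : (1 - t ^ 2) ^ ((N - 1) / 2) = 0 := by
    rw [ht, sub_self, Real.zero_rpow (by linarith)]
  simp [secondPrimitive, fluxPrimitive, h]

theorem integral_signedIntegrandDeriv2 {N ρ e x : ℝ} (a : ℝ) (hN : 3 ≤ N)
    (hρ : ρ ∈ Ioo (0 : ℝ) 1) (he : e = -1 ∨ e = 1) (hx : x ∈ Icc (-1 : ℝ) 1) :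
    ∫ t in e..x, signedIntegrandDeriv2 N a ρ t = secondPrimitive N a ρ x / ρ ^ 2 := by
  have hs : uIcc e x ⊆ Icc (-1) 1 :=
    OrdConnected.uIcc_subset inferInstance (by rcases he with rfl | rfl <;> simp) hx
  have hc : ContinuousOn (signedIntegrandDeriv2 N a ρ) (uIcc e x) :=
    (continuousOn_signedIntegrandDeriv2 hN a).comp (f := fun t => (ρ, t)) (by fun_prop)
      fun t ht => ⟨hρ, hs ht⟩
  -- The derivative is known only inside `(-1, 1)`; continuity suffices at the ends.
  have hioo : Ioo (min e x) (max e x) ⊆ Ioo (-1) 1 := by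
    have h := interior_mono hs
    rwa [uIcc, interior_Icc, interior_Icc] at h
  have h := intervalIntegral.integral_eq_sub_of_hasDeriv_right
    ((continuousOn_secondPrimitive a hN hρ).mono hs)
    (fun t ht => (hasDerivAt_secondPrimitive (a := a) hN hρ (hioo ht)).hasDerivWithinAt)
    (continuousOn_const.mul hc).intervalIntegrable
  rw [intervalIntegral.integral_const_mul, secondPrimitive_eq_zero (t := e) a ρ hN
    (by rcases he with rfl | rfl <;> norm_num), sub_zero] at h
  rw [← h, mul_div_cancel_left₀ _ (pow_ne_zero 2 hρ.1.ne')]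

/-! ### Application to `Φ`. -/

theorem phiIntegrand_eq {n : ℕ} {ρ t : ℝ} (hρ : ρ ∈ Ioo (0 : ℝ) 1) (ht : t ∈ Icc (-1 : ℝ) 1) :
    PhiIntegrand n ρ t = |t - ((n : ℝ) - 2) / n * ρ| * (1 - t ^ 2) ^ (((n : ℝ) - 3) / 2) *
      distSq ρ t ^ (-(((n : ℝ) - 2) / 2)) := by
  rw [PhiIntegrand, Real.rpow_neg (distSq_pos hρ ht).le, ← div_eq_mul_inv]
  rfl

theorem intervalIntegrable_phiIntegrand {n : ℕ} (hn : (3 : ℝ) ≤ n) {ρ : ℝ}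
    (hρ : ρ ∈ Ioo (0 : ℝ) 1) :
    IntervalIntegrable (PhiIntegrand n ρ) MeasureTheory.volume (-1) 1 := by
  have h1 : Continuous fun t : ℝ => |t - ((n : ℝ) - 2) / n * ρ| := by fun_prop
  have h2 := continuous_weight (s := ((n : ℝ) - 3) / 2) (by linarith)
  have h3 : ContinuousOn (fun t => distSq ρ t ^ (-(((n : ℝ) - 2) / 2))) (Icc (-1) 1) :=
    (continuousOn_distSq_rpow _).comp (f := fun t => (ρ, t)) (by fun_prop) fun t ht => ⟨hρ, ht⟩
  refine ContinuousOn.intervalIntegrable ?_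
  rw [uIcc_of_le (by norm_num)]
  exact ((h1.mul h2).continuousOn.mul h3).congr fun t ht => phiIntegrand_eq hρ ht

theorem slope_mul_mem_Ioo {n : ℕ} (hn : (3 : ℝ) ≤ n) {ρ : ℝ} (hρ : ρ ∈ Ioo (0 : ℝ) 1) :
    ((n : ℝ) - 2) / n * ρ ∈ Ioo (-1 : ℝ) 1 := by
  have h0 : 0 < ((n : ℝ) - 2) / n := div_pos (by linarith) (by linarith)
  have h1 : ((n : ℝ) - 2) / n < 1 := by rw [div_lt_one (by linarith)]; linarith
  have := hρ.1
  have := hρ.2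
  constructor <;> nlinarith

theorem distSq_slope {n : ℕ} (hn : (3 : ℝ) ≤ n) (ρ : ℝ) :
    distSq ρ (((n : ℝ) - 2) / n * ρ) = 1 - ((n : ℝ) - 4) / n * ρ ^ 2 := by
  have : (n : ℝ) ≠ 0 := by linarith
  unfold distSq
  field_simp
  ring

theorem sphereArg_slope {n : ℕ} (hn : (3 : ℝ) ≤ n) (ρ : ℝ) :
    sphereArg ρ (((n : ℝ) - 2) / n * ρ) = hypArg n ρ := by
  rw [sphereArg, hypArg, distSq_slope hn, mul_pow, div_pow]

theorem phi_eq {n : ℕ} (hn : (3 : ℝ) ≤ n) {ρ : ℝ} (hρ : ρ ∈ Ioo (0 : ℝ) 1) :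
    Phi n ρ =
      -(∫ t in (1 : ℝ)..(((n : ℝ) - 2) / n * ρ), signedIntegrand n (((n : ℝ) - 2) / n) ρ t)
      - ∫ t in (-1 : ℝ)..(((n : ℝ) - 2) / n * ρ), signedIntegrand n (((n : ℝ) - 2) / n) ρ t := by
  have hx := slope_mul_mem_Ioo hn hρ
  have hi := intervalIntegrable_phiIntegrand hn hρ
  have hm : ((n : ℝ) - 2) / n * ρ ∈ uIcc (-1 : ℝ) 1 := by
    rw [uIcc_of_le (by norm_num)]
    exact Ioo_subset_Icc_self hx
  rw [Phi, ← intervalIntegral.integral_add_adjacent_intervals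
    (hi.mono_set (uIcc_subset_uIcc_left hm)) (hi.mono_set (uIcc_subset_uIcc_right hm)),
    ← intervalIntegral.integral_symm, add_comm]
  have hneg : ∫ t in (-1 : ℝ)..(((n : ℝ) - 2) / n * ρ), PhiIntegrand n ρ t =
      -∫ t in (-1 : ℝ)..(((n : ℝ) - 2) / n * ρ),
        signedIntegrand n (((n : ℝ) - 2) / n) ρ t := by
    rw [← intervalIntegral.integral_neg]
    refine intervalIntegral.integral_congr fun t ht => ?_
    rw [uIcc_of_le hx.1.le] at ht
    rw [phiIntegrand_eq hρ ⟨ht.1, ht.2.trans hx.2.le⟩, abs_of_nonpos (sub_nonpos.2 ht.2)]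
    simp only [signedIntegrand, neg_mul]
  rw [hneg, ← sub_eq_add_neg]
  congr 1
  refine intervalIntegral.integral_congr fun t ht => ?_
  rw [uIcc_of_le hx.2.le] at ht
  rw [phiIntegrand_eq hρ ⟨hx.1.le.trans ht.1, ht.2⟩, abs_of_nonneg (sub_nonneg.2 ht.1)]
  rfl

theorem hasDerivAt_phi {n : ℕ} (hn : (3 : ℝ) ≤ n) {ρ : ℝ} (hρ : ρ ∈ Ioo (0 : ℝ) 1) :
    HasDerivAt (Phi n)
      (-(∫ t in (1 : ℝ)..(((n : ℝ) - 2) / n * ρ), signedIntegrandDeriv n (((n : ℝ) - 2) / n) ρ t)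
      - ∫ t in (-1 : ℝ)..(((n : ℝ) - 2) / n * ρ),
        signedIntegrandDeriv n (((n : ℝ) - 2) / n) ρ t) ρ := by
  have key : ∀ e ∈ Icc (-1 : ℝ) 1, _ := fun e he =>
    hasDerivAt_integral_leibniz isOpen_Ioo hρ (slope_mul_mem_Ioo hn hρ) he
      (continuousOn_signedIntegrand hn (((n : ℝ) - 2) / n))
      (continuousOn_signedIntegrandDeriv hn (((n : ℝ) - 2) / n))
      fun r hr t ht => hasDerivAt_signedIntegrand _ _ (distSq_pos hr ht)
  have h := (key 1 (by simp)).neg.sub (key (-1) (by simp))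
  have h0 : signedIntegrand n (((n : ℝ) - 2) / n) ρ (((n : ℝ) - 2) / n * ρ) = 0 := by
    simp [signedIntegrand]
  rw [h0, mul_zero, zero_add, zero_add] at h
  refine h.congr_of_eventuallyEq ?_
  filter_upwards [isOpen_Ioo.mem_nhds hρ] with r hr
  exact phi_eq hn hr

theorem hasDerivAt_deriv_phi {n : ℕ} (hn : (3 : ℝ) ≤ n) {ρ : ℝ} (hρ : ρ ∈ Ioo (0 : ℝ) 1) :
    HasDerivAt (deriv (Phi n))
      (-(2 * (((n : ℝ) - 2) / n *
          signedIntegrandDeriv n (((n : ℝ) - 2) / n) ρ (((n : ℝ) - 2) / n * ρ)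
        + secondPrimitive n (((n : ℝ) - 2) / n) ρ (((n : ℝ) - 2) / n * ρ) / ρ ^ 2))) ρ := by
  have hx := slope_mul_mem_Ioo hn hρ
  have key : ∀ e ∈ Icc (-1 : ℝ) 1, _ := fun e he =>
    hasDerivAt_integral_leibniz isOpen_Ioo hρ hx he
      (continuousOn_signedIntegrandDeriv hn (((n : ℝ) - 2) / n))
      (continuousOn_signedIntegrandDeriv2 hn (((n : ℝ) - 2) / n))
      fun r hr t ht => hasDerivAt_signedIntegrandDeriv _ _ (distSq_pos hr ht)
  have h := (key 1 (by simp)).neg.sub (key (-1) (by simp))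
  rw [integral_signedIntegrandDeriv2 _ hn hρ (.inr rfl) (Ioo_subset_Icc_self hx),
    integral_signedIntegrandDeriv2 _ hn hρ (.inl rfl) (Ioo_subset_Icc_self hx)] at h
  -- The two contributions coincide, hence the factor `2`.
  refine (h.congr_of_eventuallyEq ?_).congr_deriv (by ring)
  filter_upwards [isOpen_Ioo.mem_nhds hρ] with r hr
  exact (hasDerivAt_phi hn hr).deriv

theorem mainTheorem4 (n : ℕ) (hn : 3 ≤ n) :
    (∀ ρ ∈ Ioo (0 : ℝ) 1, IntervalIntegrable (PhiIntegrand n ρ) MeasureTheory.volume (-1) 1) ∧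
    (∀ ρ ∈ Ioo (0 : ℝ) 1, |hypArg n ρ| < 1) ∧
    DifferentiableOn ℝ (Phi n) (Ioo (0 : ℝ) 1) ∧
    ∀ ρ ∈ Ioo (0 : ℝ) 1,
      HasDerivAt (deriv (Phi n))
        (2 * ((n : ℝ) - 2) / ρ ^ 2
          * (1 - ((n : ℝ) - 2) ^ 2 / (n : ℝ) ^ 2 * ρ ^ 2) ^ (((n : ℝ) - 3) / 2)
          * (1 - ((n : ℝ) - 4) / n * ρ ^ 2) ^ (-((n : ℝ) / 2))
          * ((1 - ((n : ℝ) - 2) * ((n : ℝ) - 3) / (n : ℝ) ^ 2 * ρ ^ 2)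
                * (1 - ((n : ℝ) - 4) / n * ρ ^ 2)
              - (1 - ((n : ℝ) - 2) * ((n : ℝ) - 3) / ((n : ℝ) * ((n : ℝ) - 1)) * ρ ^ 2)
                * (1 - ((n : ℝ) - 2) ^ 2 / (n : ℝ) ^ 2 * ρ ^ 2)
                * (1 - ((n : ℝ) - 2) / n * ρ ^ 2)
                * ordinaryHypergeometric (1 : ℝ) ((n : ℝ) / 2) (((n : ℝ) + 1) / 2) (hypArg n ρ)))
        ρ := by
  have hn' : (3 : ℝ) ≤ n := by exact_mod_cast hn
  refine ⟨fun ρ hρ => intervalIntegrable_phiIntegrand hn' hρ, fun ρ hρ => ?_, fun ρ hρ =>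
    (hasDerivAt_phi hn' hρ).differentiableAt.differentiableWithinAt, fun ρ hρ => ?_⟩
  · rw [← sphereArg_slope hn']
    exact abs_sphereArg_lt_one hρ (Ioo_subset_Icc_self (slope_mul_mem_Ioo hn' hρ))
  · have hx := slope_mul_mem_Ioo hn' hρ
    refine (hasDerivAt_deriv_phi hn' hρ).congr_deriv ?_
    have hR := distSq_pos hρ (Ioo_subset_Icc_self hx)
    have hρ0 := hρ.1.ne'
    have hn0 : (n : ℝ) ≠ 0 := by linarith
    have hn1 : (n : ℝ) - 1 ≠ 0 := by linarith
    rw [secondPrimitive, fluxPrimitive, signedIntegrandDeriv, weight_eq (one_sub_sq_pos hx),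
      distSq_rpow_kernel hR, sphereArg_slope hn', distSq_slope hn', mul_pow, div_pow]
    -- With the powers and `₂F₁` opaque, a rational identity in `n` and `ρ` remains.
    generalize (1 - ((n : ℝ) - 2) ^ 2 / (n : ℝ) ^ 2 * ρ ^ 2) ^ (((n : ℝ) - 3) / 2) = W
    generalize (1 - ((n : ℝ) - 4) / n * ρ ^ 2) ^ (-((n : ℝ) / 2)) = H
    generalize ordinaryHypergeometric (1 : ℝ) ((n : ℝ) / 2) (((n : ℝ) + 1) / 2) (hypArg n ρ) = F
    field_simp
    ring
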